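/- Let $K$ be a field of characteristic zero and let $\mathbf{Sym}$ be the free associative $K$-algebra on indeterminates $S_1,S_2,\dots$, with $S_0=1$. Define $\Psi_n\in\mathbf{Sym}$ $(n\ge 1)$ by $$nS_n=\sum_{k=0}^{n-1}S_k\Psi_{n-k}.$$ For a composition $I=(i_1,\dots,i_r)$ with $r\ge 1$, define $\Psi_I$ by $$r\,\Psi_I=(-1)^{r-1}\,|A|_{r,1},$$ where $A$ is the $r\times r$ matrix with entries $A_{ab}=\Psi_{i_{r+1-a}+\cdots+i_{r+1-b}}$ for $b\le a$, $A_{a,a+1}=a$, and $A_{ab}=0$ for $b>a+1$. Here $|A|_{r,1}$ is the quasideterminant at the lower left entry: $|A|_{pq}=a_{pq}-\rho\,(A^{pq})^{-1}\gamma$, where $A^{pq}$ is $A$ without row $p$ and column $q$, $\rho$ is row $p$ without its entry in column $q$, and $\gamma$ is column $q$ without its entry in row $p$. Put $\Psi_\emptyset=1$. The descent set of a composition $I=(i_1,\dots,i_r)$ of $n$ is $\{i_1,i_1+i_2,\dots,i_1+\cdots+i_{r-1}\}$; a composition of $n$ is determined by its descent set, and any subset of $\{1,\dots,n-1\}$ occurs.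 A composition $J$ of $n$ is finer than $I$, and $I$ is coarser than $J$, if the descent set of $J$ contains that of $I$ (equality allowed). Write $\ell(I)$ for the number of parts of $I$ and $S^I=S_{i_1}\cdots S_{i_r}$. Set $$R_I=\sum_{J\text{ coarser than }I}(-1)^{\ell(I)-\ell(J)}S^J,\qquad L_I=\sum_{J\text{ finer than }I}\Psi_J .$$ For a permutation $\sigma=\sigma_1\cdots\sigma_n$ of $\{1,\dots,n\}$, let $D(\sigma)$ be the composition of $n$ with descent set $\{i : 1\le i<n,\ \sigma_i>\sigma_{i+1}\}$, and let the Genocchi composition $GC(\sigma)$ be the composition of $n$ with descent set $\{\sigma_i-1 : 1\le i<n,\ \sigma_i>\sigma_{i+1}\}$. **Theorem.** Let $n\ge 0$. The elements $L_J$, $J$ ranging over the compositions of $n$, are linearly independent, and for every composition $I$ of $n$ $$R_I=\sum_{J\vDash n}G_{IJ}\,L_J,$$ where $G_{IJ}$ is the number of permutations $\sigma$ of $\{1,\dots,n\}$ with $D(\sigma^{-1})=I$ and $GC(\sigma)=J$. In particular, the coefficients in the expansion of $R_I$ on the $L_J$ are uniquely determined and are nonnegative integers. -/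

import Mathlib

noncomputable section

/-- The algebra `Sym` of noncommutative symmetric functions over `K`: the free associative
algebra on indeterminates `S₁, S₂, …`. -/
abbrev NSym (K : Type*) [Field K] : Type _ := FreeAlgebra K ℕ+

/-- The quasideterminant `|A|_{pq} = a_{pq} - r (A^{pq})⁻¹ c` of a square matrix over a ring,
where `A^{pq}` is `A` without row `p` and column `q`, `r` is row `p` without its entry in
column `q`, and `c` is column `q` without its entry in row `p`.  It is meaningful when `A^{pq}`
is invertible over the (noncommutative) ring. -/
def quasidet {R : Type*} [Ring R] {k : ℕ} (A : Matrix (Fin (k + 1)) (Fin (k + 1)) R)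
    (p q : Fin (k + 1)) : R :=
  A p q - (fun j => A p (q.succAbove j)) ⬝ᵥ
    (Ring.inverse (A.submatrix p.succAbove q.succAbove)).mulVec (fun i => A (p.succAbove i) q)

namespace NSym

variable (K : Type*) [Field K]

/-- The complete functions `S_n`, with `S₀ = 1`. -/
def S : ℕ → NSym K
  | 0 => 1
  | n + 1 => FreeAlgebra.ι K n.succPNat

/-- The noncommutative power sums of the first kind `Ψ_n`, `n ≥ 1`, defined by Newton's recursion
`n S_n = S₀ Ψ_n + S₁ Ψ_{n-1} + ⋯ + S_{n-1} Ψ₁`.  (The value at `0` is irrelevant.) -/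
def powerSum : ℕ → NSym K
  | 0 => 0
  | m + 1 => ((m + 1 : ℕ) : K) • S K (m + 1) - ∑ j : Fin m, S K (m - j) * powerSum (j + 1)
decreasing_by omega

/-- The `r × r` matrix attached to `w = (i₁, …, i_r)`.  Row `a` and column `b` (numbered from `0`)
contain `Ψ_{i_{r-a} + ⋯ + i_{r-b}}` when `b ≤ a`, the integer `a + 1` when `b = a + 1`, and `0`
further to the right.  Read in the reversed word `(i_r, …, i₁)`, the index is the sum of the
letters in places `b, …, a`. -/
def monomialMatrix (w : List ℕ) (r : ℕ) : Matrix (Fin r) (Fin r) (NSym K) := fun a b =>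
  if b.val ≤ a.val then powerSum K ((w.reverse.take (a.val + 1)).drop b.val).sum
  else if b.val = a.val + 1 then ((a.val + 1 : ℕ) : NSym K)
  else 0

/-- The noncommutative monomial function `Ψ_w`, `w = (i₁, …, i_r)`: `r Ψ_w` is `(-1)^{r-1}` times
the quasideterminant of the matrix above at its lower left entry; and `Ψ_∅ = 1`. -/
def monomialOfList : List ℕ → NSym K
  | [] => 1
  | i :: w => ((w.length + 1 : ℕ) : K)⁻¹ • ((-1) ^ w.length *
      quasidet (monomialMatrix K (i :: w) (w.length + 1)) (Fin.last w.length) 0)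

variable {n : ℕ}

/-- The noncommutative monomial symmetric function `Ψ_I`. -/
def monomial (I : Composition n) : NSym K := monomialOfList K I.blocks

/-- The products `S^I = S_{i₁} ⋯ S_{i_r}`. -/
def completeProd (I : Composition n) : NSym K := (I.blocks.map (S K)).prod

/-- The noncommutative ribbon Schur function
`R_I = ∑_{J} (-1)^{ℓ(I) - ℓ(J)} S^J`, over the compositions `J` equal to or coarser than `I`. -/
def ribbon (I : Composition n) : NSym K :=
  ∑ J : Composition n with J.boundaries ⊆ I.boundaries,
    (-1) ^ (I.length - J.length) * completeProd K J

/-- The noncommutative fundamental function `L_I = ∑_J Ψ_J`, over the compositions `J` equal to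
or finer than `I`. -/
def fundamental (I : Composition n) : NSym K :=
  ∑ J : Composition n with I.boundaries ⊆ J.boundaries, monomial K J

end NSym

end

/-- The composition of `n` whose descent set is `D ∩ {1, …, n - 1}`; its partial sums are the
elements of that set together with `0` and `n`. -/
def compositionOfDescents (n : ℕ) (D : Finset ℕ) : Composition n :=
  CompositionAsSet.toComposition
    { boundaries := insert 0 (insert (Fin.last n) (Finset.univ.filter fun i => i.val ∈ D))
      zero_mem := by simp
      getLast_mem := by simp }

/-! A permutation of `{1, …, n}` is modelled by `σ : Equiv.Perm (Fin n)`, its one-line notation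
being `σ 0 + 1, σ 1 + 1, …`. -/

/-- The set of positions (numbered from `1`) of the descents of `σ`. -/
def descentPositions {n : ℕ} (σ : Equiv.Perm (Fin n)) : Finset ℕ :=
  (Finset.univ.filter fun i : Fin n => ∃ j : Fin n, j.val = i.val + 1 ∧ σ j < σ i).image
    fun i => i.val + 1

/-- The Genocchi descent set: the set of values (numbered from `1`) of the descents of `σ`. -/
def genocchiDescents {n : ℕ} (σ : Equiv.Perm (Fin n)) : Finset ℕ :=
  (Finset.univ.filter fun i : Fin n => ∃ j : Fin n, j.val = i.val + 1 ∧ σ j < σ i).image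
    fun i => (σ i).val + 1

/-- The descent composition `D(σ)`. -/
def descentComposition {n : ℕ} (σ : Equiv.Perm (Fin n)) : Composition n :=
  compositionOfDescents n (descentPositions σ)

/-- The Genocchi composition `GC(σ)`, with descent set `{d - 1 | d ∈ GDes(σ)}`. -/
def genocchiComposition {n : ℕ} (σ : Equiv.Perm (Fin n)) : Composition n :=
  compositionOfDescents n ((genocchiDescents σ).image fun d => d - 1)

/-- The number of permutations `σ` of `{1, …, n}` with `D(σ⁻¹) = I` and `GC(σ) = J`. -/
def genocchiNumber {n : ℕ} (I J : Composition n) : ℕ :=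
  (Finset.univ.filter fun σ : Equiv.Perm (Fin n) =>
    descentComposition σ⁻¹ = I ∧ genocchiComposition σ = J).card

/-! The heart is the expansion of the products `S^I` on the `L_J`: `S^I` is the sum of `L_{GC(σ)}`
over all `σ` with `D(σ⁻¹)` coarser than `I`. Since `S^I` is the sum of the ribbons `R_C` over `C`
coarser than `I`, Möbius inversion on the Boolean lattice of descent sets then gives the formula for
`R_I`. Linear independence follows as well: the `S^I` are distinct words of a free algebra and lie
in the span of the equally numerous `L_J`.

On the algebraic side, the quasideterminant amounts to a recursion for `Ψ_I`
(`length_smul_monomialOfList`), hence to a two-term rule for `Ψ_p Ψ_I`. With Newton's recursion this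
gives `S_n Ψ_I`, and iterating, the coefficient of `Ψ_J` in `S^I` (`prod_S_eq_wordSum`). For `n ≥ 1`
it is the product over `k` of the binomials `(i_k + a_k - 1).choose i_k`, where `a_k` counts the
partial sums of `J` that are at least `i₁ + ⋯ + i_k`.

On the combinatorial side, this product counts the `σ` with `D(σ⁻¹)` coarser than `I` and `GC(σ)`
coarser than `J`. Values are inserted from the largest to the smallest. The Genocchi condition
allows a new minimum only in the first place or right after a value marked by `J`, so its place is
encoded by the number of marked values before it. The descent condition says that within a block of
values cut out by `I` each code is at most the code of the next value; weakly monotone code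
sequences are counted by one binomial per block (`card_boundedPerms_block`).

Since `Ψ_J` occurs in `L_C` exactly when `C` is coarser than `J`, equality of the two numbers is the
expansion of `S^I` on the `L_J`. -/

noncomputable section

/-! ### Quasideterminants and triangular systems -/

/-- A lower triangular matrix over a (noncommutative) ring is invertible if its diagonal entries
are. -/
theorem Matrix.isUnit_of_lower_triangular {R : Type*} [Ring R] {k : ℕ}
    (M : Matrix (Fin k) (Fin k) R) (h0 : ∀ a b, a < b → M a b = 0)
    (hd : ∀ a, IsUnit (M a a)) : IsUnit M := by
  choose u hu using hd
  set U : Matrix (Fin k) (Fin k) R := Matrix.diagonal fun a => (u a : R) with hU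
  set V : Matrix (Fin k) (Fin k) R := Matrix.diagonal fun a => ((u a)⁻¹ : Rˣ).val with hV
  have hUV : U * V = 1 := by simp [hU, hV]
  have hVU : V * U = 1 := by simp [hU, hV]
  have hUu : IsUnit U := ⟨⟨U, V, hUV, hVU⟩, rfl⟩
  -- After the diagonal is normalised to `1`, what remains is strictly lower triangular, hence
  -- nilpotent, and `M = U (1 + N)`.
  set N : Matrix (Fin k) (Fin k) R := V * M - 1 with hN
  have hN0 : ∀ a b : Fin k, a ≤ b → N a b = 0 := by
    intro a b hab
    rcases hab.lt_or_eq with h | rfl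
    · simp [hN, hV, Matrix.diagonal_mul, h0 a b h, Matrix.one_apply_ne h.ne]
    · simp [hN, hV, Matrix.diagonal_mul, ← hu]
  have hpow : ∀ (j : ℕ) (a b : Fin k), a.val < b.val + j → (N ^ j) a b = 0 := by
    intro j
    induction j with
    | zero => intro a b h; simp [Matrix.one_apply_ne (show a ≠ b by rintro rfl; omega)]
    | succ j ih =>
      intro a b h
      rw [pow_succ, Matrix.mul_apply]
      refine Finset.sum_eq_zero fun c _ => ?_
      by_cases hc : a.val < c.val + j
      · rw [ih a c hc, zero_mul]
      · rw [hN0 c b (by rw [Fin.le_def]; omega), mul_zero]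
  have hnil : IsNilpotent N := ⟨k, by ext a b; exact hpow k a b (by omega)⟩
  have hM : M = U * (1 + N) := by
    rw [hN, add_sub_cancel, ← mul_assoc, hUV, one_mul]
  rw [hM]
  exact hUu.mul hnil.isUnit_one_add

/-- The quasideterminant in terms of the solution of the associated linear system. -/
theorem quasidet_eq_of_mulVec_eq {R : Type*} [Ring R] {k : ℕ}
    (A : Matrix (Fin (k + 1)) (Fin (k + 1)) R) (p q : Fin (k + 1)) (x : Fin k → R)
    (hA : IsUnit (A.submatrix p.succAbove q.succAbove))
    (hx : (A.submatrix p.succAbove q.succAbove).mulVec x = fun i => A (p.succAbove i) q) :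
    quasidet A p q = A p q - ∑ j, A p (q.succAbove j) * x j := by
  rw [quasidet, ← hx, Matrix.mulVec_mulVec, Ring.inverse_mul_cancel _ hA, Matrix.one_mulVec]
  rfl

/-! ### Recursion and product rule for the monomial functions -/

namespace NSym

variable (K : Type*) [Field K]

/-- Undoes the reversal in the matrix: up to the diagonal, row `a` involves only the suffix of `w`
with `a + 1` letters. This is what makes an induction over suffixes possible. -/
theorem monomialMatrix_apply_of_le {w : List ℕ} {l : ℕ} (hw : w.length = l + 1)
    {a b : Fin (l + 1)} (h : b ≤ a) :
    monomialMatrix K w (l + 1) a b =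
      powerSum K ((w.drop (l - a)).take (a + 1 - b)).sum := by
  have ha := a.isLt
  rw [monomialMatrix, if_pos (Fin.le_def.1 h), List.take_reverse, List.drop_reverse,
    List.sum_reverse]
  simp only [List.length_drop, hw]
  congr 4 <;> omega

/-- The alternating sum in the recursion for noncommutative monomial functions. -/
theorem neg_one_pow_mul_alternating_sum {R : Type*} [Ring R] (P M : ℕ → R) (a : ℕ) (hM : M 0 = 1) :
    (-1) ^ a * ∑ k ∈ Finset.range (a + 1), (-1) ^ k * (P (k + 1) * M (a - k)) =
      P (a + 1) - ∑ b ∈ Finset.range a, P (a - b) * ((-1) ^ b * M (b + 1)) := by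
  rw [Finset.sum_range_succ, mul_add, ← mul_assoc, ← pow_add, ← two_mul, pow_mul]
  simp only [even_two, Even.neg_pow, one_pow, Nat.sub_self, hM, mul_one, one_mul]
  rw [add_comm, sub_eq_add_neg, add_right_inj, ← Finset.sum_range_reflect, Finset.mul_sum,
    ← Finset.sum_neg_distrib]
  refine Finset.sum_congr rfl fun b hb => ?_
  have hb := Finset.mem_range.1 hb
  have hc : Commute ((-1 : R) ^ b) (P (a - b)) := ((Commute.one_left _).neg_left).pow_left b
  rw [show a - 1 - b + 1 = a - b by omega, show a - (a - 1 - b) = b + 1 by omega, ← mul_assoc,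
    ← pow_add, show a + (a - 1 - b) = 2 * (a - 1 - b) + (b + 1) by omega, pow_add, pow_mul,
    neg_one_sq, one_pow, one_mul, pow_succ, mul_neg_one, neg_mul, ← mul_assoc (P _), ← hc.eq,
    mul_assoc]

/-- Without its last row and first column the matrix is lower triangular with diagonal `1, …, l`,
invertible in characteristic zero. Row `a` of the resulting linear system is, up to sign, this same
recursion for the suffix with `a + 1` letters, so by induction the suffixes solve the system, and
the last row gives the recursion for `w`. -/
theorem length_smul_monomialOfList [CharZero K] (l : ℕ) : ∀ w : List ℕ, w.length = l + 1 →
    ((l + 1 : ℕ) : K) • monomialOfList K w = ∑ k ∈ Finset.range (l + 1),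
      (-1) ^ k * (powerSum K (w.take (k + 1)).sum * monomialOfList K (w.drop (k + 1))) := by
  induction l using Nat.strong_induction_on with
  | _ l ih =>
  intro w hw
  have key : ∀ a ≤ l, (-1) ^ a * ∑ k ∈ Finset.range (a + 1), (-1) ^ k *
      (powerSum K ((w.drop (l - a)).take (k + 1)).sum *
        monomialOfList K ((w.drop (l - a)).drop (k + 1))) =
      powerSum K ((w.drop (l - a)).take (a + 1)).sum -
        ∑ b ∈ Finset.range a, powerSum K ((w.drop (l - a)).take (a - b)).sum *
          ((-1) ^ b * monomialOfList K (w.drop (l - b))) := by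
    intro a ha
    have := neg_one_pow_mul_alternating_sum
      (fun k => powerSum K ((w.drop (l - a)).take k).sum)
      (fun b => monomialOfList K (w.drop (l + 1 - b))) a
      (by simp [← hw, monomialOfList])
    simp only [Nat.add_sub_add_right] at this
    rw [← this]
    congr 1
    refine Finset.sum_congr rfl fun k hk => ?_
    have hk := Finset.mem_range.1 hk
    rw [List.drop_drop, show l - a + (k + 1) = l + 1 - (a - k) by omega]
  obtain ⟨i, v, rfl⟩ : ∃ i v, w = i :: v := by
    cases w with
    | nil => simp at hw
    | cons i v => exact ⟨i, v, rfl⟩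
  have hv : v.length = l := by simpa using hw
  subst hv
  set l := v.length with hl
  set w := i :: v with hwv
  set A := monomialMatrix K w (l + 1) with hA
  -- The solution of the system: coordinate `b` is, up to sign, the monomial function of the suffix
  -- with `b + 1` letters.
  set x : Fin l → NSym K := fun b => (-1) ^ b.val * monomialOfList K (w.drop (l - b)) with hx
  have hzero : ∀ a b : Fin (l + 1), a.val + 1 < b.val → A a b = 0 := by
    intro a b h
    rw [hA, monomialMatrix, if_neg (by omega), if_neg (by omega)]
  have hsup : ∀ a b : Fin (l + 1), b.val = a.val + 1 → A a b = ((a.val + 1 : ℕ) : NSym K) := by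
    intro a b h
    rw [hA, monomialMatrix, if_neg (by omega), if_pos h]
  have hrow : ∀ a : Fin (l + 1), ∑ b : Fin l, (if b.val < a.val then A a b.succ * x b else 0) =
      ∑ b ∈ Finset.range a, powerSum K ((w.drop (l - a)).take (a - b)).sum *
          ((-1) ^ b * monomialOfList K (w.drop (l - b))) := by
    intro a
    have ha := a.isLt
    have : ∀ b : Fin l, (if b.val < a.val then A a b.succ * x b else 0) =
        (fun b : ℕ => if b < a.val then powerSum K ((w.drop (l - a)).take (a - b)).sum *
          ((-1) ^ b * monomialOfList K (w.drop (l - b))) else 0) b := by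
      intro b
      dsimp only
      split_ifs with h
      · rw [hA, monomialMatrix_apply_of_le K hw (by rw [Fin.le_def]; simpa using h), hx,
          Fin.val_succ, Nat.add_sub_add_right]
      · rfl
    rw [Finset.sum_congr rfl fun b _ => this b, Fin.sum_univ_eq_sum_range (fun b : ℕ =>
      if b < a.val then powerSum K ((w.drop (l - a)).take (a - b)).sum *
          ((-1) ^ b * monomialOfList K (w.drop (l - b))) else 0) l, ← Finset.sum_filter]
    congr 1
    ext b
    simp only [Finset.mem_filter, Finset.mem_range]
    omega
  have hcol : ∀ a : Fin (l + 1), A a 0 = powerSum K ((w.drop (l - a)).take (a + 1)).sum := by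
    intro a
    rw [hA, monomialMatrix_apply_of_le K hw (Fin.zero_le a)]
    simp
  have hq : quasidet A (Fin.last l) 0 =
      A (Fin.last l) 0 - ∑ j, A (Fin.last l) ((0 : Fin (l + 1)).succAbove j) * x j := by
    apply quasidet_eq_of_mulVec_eq
    · apply Matrix.isUnit_of_lower_triangular
      · intro a b hab
        apply hzero
        have := Fin.lt_def.1 hab
        simpa using this
      · intro a
        rw [Matrix.submatrix_apply, hsup _ _ (by simp)]
        have h1 : ((a.val + 1 : ℕ) : K) ≠ 0 := Nat.cast_ne_zero.2 (Nat.succ_ne_zero _)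
        have := (IsUnit.mk0 _ h1).map (algebraMap K (NSym K))
        simpa using this
    · funext a
      have e1 := hrow a.castSucc
      have e2 := key a.val a.isLt.le
      have e3 := ih a.val a.isLt (w.drop (l - a)) (by have := a.isLt; simp [hw]; omega)
      rw [← e3] at e2
      simp only [Fin.val_castSucc] at e1
      have e4 := hcol a.castSucc
      simp only [Fin.val_castSucc] at e4
      rw [← e1, ← e4, eq_sub_iff_add_eq'] at e2
      change ∑ c, A.submatrix (Fin.last l).succAbove (Fin.succAbove 0) a c * x c = _
      rw [Fin.succAbove_last, ← e2]
      have e5 : (-1) ^ a.val * ((a.val + 1 : ℕ) : K) • monomialOfList K (w.drop (l - a)) =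
          ∑ c : Fin l, if c = a then A a.castSucc c.succ * x c else 0 := by
        rw [Finset.sum_ite_eq' Finset.univ a, if_pos (Finset.mem_univ _),
          hsup _ _ (by simp), hx, Fin.val_castSucc, mul_smul_comm, ← nsmul_eq_mul,
          Nat.cast_smul_eq_nsmul]
      rw [e5, ← Finset.sum_add_distrib]
      refine Finset.sum_congr rfl fun c _ => ?_
      rw [Matrix.submatrix_apply, Fin.succAbove_zero]
      rcases lt_trichotomy c a with h | h | h
      · rw [if_pos (Fin.lt_def.1 h), if_neg h.ne, add_zero]
      · rw [if_neg (by rw [h]; exact lt_irrefl _), if_pos h, zero_add]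
      · rw [if_neg (by rw [Fin.lt_def] at h; omega), if_neg h.ne', zero_add,
          hzero _ _ (by rw [Fin.lt_def] at h; simpa using h), zero_mul]
  have hlast : quasidet A (Fin.last l) 0 = (-1) ^ l * ∑ k ∈ Finset.range (l + 1), (-1) ^ k *
      (powerSum K (w.take (k + 1)).sum * monomialOfList K (w.drop (k + 1))) := by
    have e1 := hrow (Fin.last l)
    have e2 := key l le_rfl
    have e3 := hcol (Fin.last l)
    simp only [Fin.val_last, Nat.sub_self, List.drop_zero] at e1 e2 e3
    rw [hq, e3, e2, ← e1]
    congr 1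
    refine Finset.sum_congr rfl fun b _ => ?_
    rw [if_pos b.isLt, Fin.succAbove_zero]
  have h1 : ((l + 1 : ℕ) : K) ≠ 0 := Nat.cast_ne_zero.2 (Nat.succ_ne_zero _)
  change ((l + 1 : ℕ) : K) • ((l + 1 : ℕ) : K)⁻¹ • ((-1) ^ l * quasidet A (Fin.last l) 0) = _
  rw [smul_inv_smul₀ h1, hlast, ← mul_assoc, ← pow_add,
    ← two_mul, pow_mul, neg_one_sq, one_pow, one_mul]

/-- Left multiplication of a monomial function by a power sum. -/
theorem powerSum_mul_monomialOfList_cons [CharZero K] (p j : ℕ) (w : List ℕ) :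
    powerSum K p * monomialOfList K (j :: w) =
      ((w.length + 2 : ℕ) : K) • monomialOfList K (p :: j :: w) +
        ((w.length + 1 : ℕ) : K) • monomialOfList K ((p + j) :: w) := by
  -- Term `k + 1` of the recursion for `p :: j :: w` cancels against term `k` for `(p + j) :: w`;
  -- only term `0` of the former survives.
  rw [length_smul_monomialOfList K (w.length + 1) (p :: j :: w) (by simp),
    length_smul_monomialOfList K w.length ((p + j) :: w) (by simp), Finset.sum_range_succ',
    add_right_comm, ← Finset.sum_add_distrib, Finset.sum_eq_zero, zero_add]
  · simp
  · intro k _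
    simp [pow_succ, add_assoc]

theorem powerSum_eq_monomialOfList [CharZero K] (p : ℕ) :
    powerSum K p = monomialOfList K [p] := by
  have := length_smul_monomialOfList K 0 [p] rfl
  simpa [monomialOfList] using this.symm

/-- Newton's recursion. -/
theorem natCast_smul_S (n : ℕ) :
    (n : K) • S K n = ∑ k ∈ Finset.range n, S K (n - 1 - k) * powerSum K (k + 1) := by
  cases n with
  | zero => simp
  | succ m =>
    rw [Finset.sum_range_succ, powerSum,
      Fin.sum_univ_eq_sum_range (fun j => S K (m - j) * powerSum K (j + 1)) m]
    simp [S]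

end NSym
end

/-! ### Words, and products of complete functions on monomial functions -/

noncomputable section

/-- The distances between consecutive letters `true` of a word, the first one increased by `c`. -/
def wordParts : ℕ → List Bool → List ℕ
  | _, [] => []
  | c, true :: x => (c + 1) :: wordParts 0 x
  | c, false :: x => wordParts (c + 1) x

theorem length_wordParts (c : ℕ) (x : List Bool) : (wordParts c x).length = x.count true := by
  induction x generalizing c with
  | nil => rfl
  | cons b x ih => cases b <;> simp [wordParts, ih]

theorem wordParts_replicate_append (c q : ℕ) (x : List Bool) :
    wordParts c (List.replicate q false ++ x) = wordParts (c + q) x := by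
  induction q generalizing c with
  | zero => rfl
  | succ q ih => rw [List.replicate_succ, List.cons_append, wordParts, ih]; congr 1; omega

theorem wordParts_add (c d : ℕ) (x : List Bool) :
    (wordParts d x = [] ∧ wordParts (c + d) x = []) ∨
      ∃ j w, wordParts d x = j :: w ∧ wordParts (c + d) x = (c + j) :: w := by
  induction x generalizing d with
  | nil => exact Or.inl ⟨rfl, rfl⟩
  | cons b x ih =>
    cases b
    · exact ih (d + 1)
    · exact Or.inr ⟨d + 1, wordParts 0 x, rfl, rfl⟩

/-- A sum over the words of length `n` in two letters. -/
def wordSum {M : Type*} [AddCommMonoid M] (n : ℕ) (F : List Bool → M) : M :=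
  ∑ v : Fin n → Bool, F (List.ofFn v)

section wordSum

variable {M : Type*} [AddCommMonoid M]

theorem wordSum_zero (F : List Bool → M) : wordSum 0 F = F [] := by
  simp [wordSum]

theorem wordSum_succ (n : ℕ) (F : List Bool → M) :
    wordSum (n + 1) F =
      wordSum n (fun y => F (false :: y)) + wordSum n fun y => F (true :: y) := by
  rw [wordSum, ← (Fin.consEquiv fun _ => Bool).sum_comp, Fintype.sum_prod_type, Fintype.sum_bool,
    add_comm]
  simp [wordSum, Fin.consEquiv, List.ofFn_succ]

theorem wordSum_add (n m : ℕ) (F : List Bool → M) :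
    wordSum (n + m) F = wordSum n fun y => wordSum m fun x => F (y ++ x) := by
  induction n generalizing F with
  | zero => simp [wordSum_zero]
  | succ n ih =>
    rw [show n + 1 + m = n + m + 1 by omega, wordSum_succ, wordSum_succ, ih, ih]
    rfl

theorem wordSum_congr {n : ℕ} {F G : List Bool → M} (h : ∀ y, y.length = n → F y = G y) :
    wordSum n F = wordSum n G :=
  Finset.sum_congr rfl fun v _ => h _ (by simp)

end wordSum

namespace NSym

variable (K : Type*) [Field K]

/-- The monomial function of the composition with boundaries at the letters `true` of a word. -/
def wordMonomial (x : List Bool) : NSym K := monomialOfList K (wordParts 0 x)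

/-- The product rule in words: the letter in front of `x` decides whether the new part stays
separate or is merged with the first part of `x`. If `x` has no letter `true`, the merged term has
weight `0`. -/
theorem powerSum_succ_mul_wordMonomial [CharZero K] (q : ℕ) (x : List Bool) :
    powerSum K (q + 1) * wordMonomial K x =
      (x.count true + 1) • wordMonomial K (List.replicate q false ++ true :: x) +
        (x.count true) • wordMonomial K (List.replicate q false ++ false :: x) := by
  have h1 : wordMonomial K (List.replicate q false ++ true :: x) =
      monomialOfList K ((q + 1) :: wordParts 0 x) := by
    rw [wordMonomial, wordParts_replicate_append, zero_add, wordParts]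
  have h2 : wordMonomial K (List.replicate q false ++ false :: x) =
      monomialOfList K (wordParts (q + 1 + 0) x) := by
    rw [wordMonomial, wordParts_replicate_append, zero_add, wordParts, add_zero]
  rw [h1, h2, wordMonomial, ← length_wordParts 0 x]
  rcases wordParts_add (q + 1) 0 x with ⟨h3, h4⟩ | ⟨j, w, h3, h4⟩
  · rw [h3, h4, powerSum_eq_monomialOfList, show monomialOfList K [] = 1 from rfl]
    simp
  · rw [h3, h4, powerSum_mul_monomialOfList_cons, Nat.cast_smul_eq_nsmul, Nat.cast_smul_eq_nsmul]
    rfl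

/-- The sum of the monomial functions of all words obtained by putting `n` letters in front of
`x`. -/
def extensionSum (n : ℕ) (x : List Bool) : NSym K := wordSum n fun y => wordMonomial K (y ++ x)

theorem extensionSum_zero (x : List Bool) : extensionSum K 0 x = wordMonomial K x := by
  simp [extensionSum, wordSum_zero]

theorem extensionSum_succ (n : ℕ) (x : List Bool) :
    extensionSum K (n + 1) x = extensionSum K n (false :: x) + extensionSum K n (true :: x) := by
  rw [extensionSum, wordSum_add, extensionSum, extensionSum, wordSum, wordSum, wordSum,
    ← Finset.sum_add_distrib]
  refine Finset.sum_congr rfl fun v _ => ?_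
  rw [wordSum_succ, wordSum_zero, wordSum_zero]
  simp

/-- Half of a simultaneous induction with `sum_S_mul_wordMonomial`. Newton's recursion and the
product rule turn `(n + 1) S_{n+1} Ψ` into the sums of the hypothesis for `true :: x` and `false ::
x`. -/
theorem S_succ_mul_wordMonomial_of_sum [CharZero K] (n : ℕ)
    (h : ∀ z, ∑ p ∈ Finset.range (n + 1), S K (n - p) *
      wordMonomial K (List.replicate p false ++ z) =
        (n + z.count true).choose n • extensionSum K n z) (x : List Bool) :
    S K (n + 1) * wordMonomial K x =
      (n + 1 + x.count true).choose (n + 1) • extensionSum K n (true :: x) +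
        (n + x.count true).choose (n + 1) • extensionSum K n (false :: x) := by
  have h1 : ((n + 1 : ℕ) : K) ≠ 0 := Nat.cast_ne_zero.2 (Nat.succ_ne_zero _)
  apply smul_right_injective _ h1
  dsimp only
  rw [← smul_mul_assoc, natCast_smul_S, Finset.sum_mul]
  have h2 : ∀ k ∈ Finset.range (n + 1), S K (n + 1 - 1 - k) * powerSum K (k + 1) *
      wordMonomial K x =
      (x.count true + 1) • (S K (n - k) * wordMonomial K (List.replicate k false ++ true :: x)) +
      (x.count true) • (S K (n - k) * wordMonomial K (List.replicate k false ++ false :: x)) := by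
    intro k _
    rw [mul_assoc, powerSum_succ_mul_wordMonomial, mul_add, mul_smul_comm, mul_smul_comm,
      Nat.add_sub_cancel]
  rw [Finset.sum_congr rfl h2, Finset.sum_add_distrib, ← Finset.smul_sum, ← Finset.smul_sum, h, h,
    Nat.cast_smul_eq_nsmul, smul_add, ← mul_smul, ← mul_smul, ← mul_smul, ← mul_smul]
  -- The weights from the product rule are absorbed by `(m.choose (n + 1)) (n + 1) = (m.choose n) (m
  -- - n)`, which releases the factor `n + 1`.
  have e1 := Nat.choose_succ_right_eq (n + 1 + x.count true) n
  have e2 := Nat.choose_succ_right_eq (n + x.count true) n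
  rw [show n + 1 + x.count true - n = x.count true + 1 by omega] at e1
  rw [Nat.add_sub_cancel_left] at e2
  rw [mul_comm (n + 1), mul_comm (n + 1), e1, e2]
  simp only [List.count_cons_self, List.count_cons_of_ne (by decide : (false : Bool) ≠ true)]
  rw [mul_comm, mul_comm (List.count true x), add_right_comm n 1, add_assoc n]

/-- The terms with `p > 0` form the case `n` for `false :: z`; the term `p = 0` is the product rule
for `S_{n+1}`; Pascal's rule joins the two. -/
theorem sum_S_mul_wordMonomial [CharZero K] (n : ℕ) (z : List Bool) :
    ∑ p ∈ Finset.range (n + 1), S K (n - p) * wordMonomial K (List.replicate p false ++ z) =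
      (n + z.count true).choose n • extensionSum K n z := by
  induction n generalizing z with
  | zero => simp [S, extensionSum_zero]
  | succ n ih =>
    have h := ih (false :: z)
    simp only [List.count_cons_of_ne (by decide : (false : Bool) ≠ true)] at h
    rw [Finset.sum_range_succ']
    have h2 : ∀ p, List.replicate (p + 1) false ++ z = List.replicate p false ++ false :: z := by
      intro p
      rw [List.replicate_succ', List.append_assoc, List.singleton_append]
    simp only [Nat.add_sub_add_right, h2]
    rw [h, List.replicate_zero, List.nil_append, Nat.sub_zero,
      S_succ_mul_wordMonomial_of_sum K n ih, extensionSum_succ, smul_add,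
      show n + 1 + z.count true = n + z.count true + 1 by omega, Nat.choose_succ_succ', add_smul,
      add_smul]
    abel

theorem S_succ_mul_wordMonomial [CharZero K] (n : ℕ) (x : List Bool) :
    S K (n + 1) * wordMonomial K x =
      (n + 1 + x.count true).choose (n + 1) • extensionSum K n (true :: x) +
        (n + x.count true).choose (n + 1) • extensionSum K n (false :: x) :=
  S_succ_mul_wordMonomial_of_sum K n (sum_S_mul_wordMonomial K n) x

end NSym

/-- The coefficient of the monomial function of a word in a product of complete functions. -/
def wordCoeff : List ℕ → List Bool → ℕ
  | [], _ => 1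
  | n :: I, y => (n + (y.drop (n - 1)).count true - 1).choose n * wordCoeff I (y.drop n)

namespace NSym

variable (K : Type*) [Field K]

/-- Multiplying by a further `S_{n+1}` puts `n` free letters and one weighted letter in front. Words
ending in `false` are included, although `wordParts` forgets their last letters; `wordCoeff_eq_zero`
shows that they contribute nothing. -/
theorem prod_S_eq_wordSum [CharZero K] (I : List ℕ) (hI : ∀ i ∈ I, 0 < i) :
    (I.map (S K)).prod = wordSum I.sum fun y => wordCoeff I y • wordMonomial K y := by
  induction I with
  | nil => simp [wordSum_zero, wordCoeff, wordMonomial, wordParts, monomialOfList]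
  | cons n I ih =>
    obtain ⟨n, rfl⟩ : ∃ k, n = k + 1 := ⟨n - 1, by have := hI n (by simp); omega⟩
    rw [List.map_cons, List.prod_cons, ih fun i hi => hI i (by simp [hi]), List.sum_cons,
      add_assoc, wordSum_add, add_comm 1]
    have h1 : ∀ y : List Bool, y.length = n →
        (wordSum (I.sum + 1) fun x =>
          wordCoeff ((n + 1) :: I) (y ++ x) • wordMonomial K (y ++ x)) =
        wordSum I.sum fun x => wordCoeff I x •
          ((n + 1 + x.count true).choose (n + 1) • wordMonomial K (y ++ true :: x) +
          (n + x.count true).choose (n + 1) • wordMonomial K (y ++ false :: x)) := by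
      intro y hy
      subst hy
      rw [wordSum_succ, wordSum, wordSum, ← Finset.sum_add_distrib]
      refine Finset.sum_congr rfl fun v _ => ?_
      have h3 : ∀ b, (y ++ b :: List.ofFn v).drop (y.length + 1) = List.ofFn v := by
        intro b
        rw [← List.drop_drop, List.drop_left]; rfl
      -- The count in `wordCoeff` includes the weighted letter itself, so the two binomials of
      -- `S_succ_mul_wordMonomial` become one formula.
      simp only [wordCoeff, Nat.add_sub_cancel, List.drop_left, h3, List.count_cons_self,
        List.count_cons_of_ne (by decide : (false : Bool) ≠ true)]
      rw [smul_add, ← mul_smul, ← mul_smul, add_comm, mul_comm (wordCoeff _ _),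
        mul_comm (wordCoeff _ _)]
      congr 4; omega
    rw [wordSum_congr h1]
    simp only [wordSum]
    rw [Finset.sum_comm, Finset.mul_sum]
    refine Finset.sum_congr rfl fun v _ => ?_
    rw [mul_smul_comm, S_succ_mul_wordMonomial, ← Finset.smul_sum, Finset.sum_add_distrib,
      ← Finset.smul_sum, ← Finset.smul_sum]
    rfl

end NSym
end

/-! ### Counting permutations by inserting minima -/

/-! `π : Equiv.Perm (Fin N)` below stands for the inverse of a permutation, sending values to
positions. -/

/-- The values of the descents of `π⁻¹` lie in `A`. -/
abbrev GenocchiBounded {N : ℕ} (A : ℕ → Bool) (π : Equiv.Perm (Fin N)) : Prop :=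
  ∀ v w : Fin N, (π w).val = (π v).val + 1 → w < v → A v

/-- The descents of `π` lie in `D`. -/
abbrev DescentBounded {N : ℕ} (D : ℕ → Bool) (π : Equiv.Perm (Fin N)) : Prop :=
  ∀ v w : Fin N, w.val = v.val + 1 → π w < π v → D w

/-- The number of values in `A` in the positions before `p`. -/
def countBefore {N : ℕ} (A : ℕ → Bool) (τ : Equiv.Perm (Fin N)) (p : ℕ) : ℕ :=
  (Finset.univ.filter fun w : Fin N => A w ∧ (τ w).val < p).card

/-- The number of nonzero values in `A` that stand before the value `0`. -/
def firstCode {N : ℕ} (A : ℕ → Bool) (π : Equiv.Perm (Fin N)) : ℕ :=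
  (Finset.univ.filter fun w : Fin N => A w ∧ ∃ z : Fin N, z.val = 0 ∧ z < w ∧ π w < π z).card

/-- The permutations with bounded Genocchi descents and bounded descents. -/
def boundedPerms (N : ℕ) (A D : ℕ → Bool) : Finset (Equiv.Perm (Fin N)) :=
  Finset.univ.filter fun π => GenocchiBounded A π ∧ DescentBounded D π

/-- Increase all values by one and insert the value `0` at position `p`. -/
def insertMin {N : ℕ} (p : Fin (N + 1)) (τ : Equiv.Perm (Fin N)) : Equiv.Perm (Fin (N + 1)) :=
  (finSuccEquiv' 0).trans ((Equiv.optionCongr τ).trans (finSuccEquiv' p).symm)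

@[simp]
theorem insertMin_zero {N : ℕ} (p : Fin (N + 1)) (τ : Equiv.Perm (Fin N)) :
    insertMin p τ 0 = p := by
  simp [insertMin]

@[simp]
theorem insertMin_succ {N : ℕ} (p : Fin (N + 1)) (τ : Equiv.Perm (Fin N)) (v : Fin N) :
    insertMin p τ v.succ = p.succAbove (τ v) := by
  rw [show v.succ = (0 : Fin (N + 1)).succAbove v by simp]
  simp only [insertMin, Equiv.trans_apply, finSuccEquiv'_succAbove, Equiv.optionCongr_apply,
    Option.map_some, finSuccEquiv'_symm_some]

theorem insertMin_surjective {N : ℕ} (π : Equiv.Perm (Fin (N + 1))) :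
    ∃ p τ, π = insertMin p τ := by
  have : Function.Bijective fun x : Fin (N + 1) × Equiv.Perm (Fin N) => insertMin x.1 x.2 := by
    rw [Fintype.bijective_iff_injective_and_card]
    constructor
    · rintro ⟨p, τ⟩ ⟨q, ρ⟩ h
      dsimp only at h
      have hp : p = q := by rw [← insertMin_zero p τ, h, insertMin_zero]
      subst hp
      congr 1
      ext v
      have := congrArg (fun f => f v.succ) h
      simp only [insertMin_succ] at this
      rw [Fin.succAbove_right_injective this]
    · simp [Fintype.card_perm, Nat.factorial_succ]
  obtain ⟨⟨p, τ⟩, h⟩ := this.2 π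
  exact ⟨p, τ, h.symm⟩

/-- `p` is the first position or comes right after a value in `A`. -/
def AllowedPosition {N : ℕ} (A : ℕ → Bool) (τ : Equiv.Perm (Fin N)) (p : ℕ) : Prop :=
  ∀ u : Fin N, p = (τ u).val + 1 → A u

theorem succAbove_val_lt {N : ℕ} (p : Fin (N + 1)) (i : Fin N) :
    (p.succAbove i).val < p.val ↔ i.val < p.val := by
  rw [Fin.succAbove]
  split_ifs with h
  · simp
  · simp [Fin.lt_def] at h ⊢; omega

theorem succAbove_val {N : ℕ} (p : Fin (N + 1)) (i : Fin N) :
    (p.succAbove i).val = if i.val < p.val then i.val else i.val + 1 := by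
  rw [Fin.succAbove]
  simp only [Fin.lt_def, Fin.val_castSucc]
  split_ifs <;> simp

/-- The new minimum is the bottom of a descent whose top is the value right before it. A descent
destroyed by the insertion has this same top, so its condition is not lost. -/
theorem genocchiBounded_insertMin {N : ℕ} (A : ℕ → Bool) (p : Fin (N + 1))
    (τ : Equiv.Perm (Fin N)) :
    GenocchiBounded A (insertMin p τ) ↔
      GenocchiBounded (fun i => A (i + 1)) τ ∧ AllowedPosition (fun i => A (i + 1)) τ p := by
  constructor
  · intro h
    have hp : AllowedPosition (fun i => A (i + 1)) τ p := by
      intro u hu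
      have := h u.succ 0 (by
        rw [insertMin_zero, insertMin_succ, succAbove_val, if_pos (by omega)]; exact hu)
        (Fin.succ_pos u)
      simpa using this
    refine ⟨fun v w hvw hlt => ?_, hp⟩
    by_cases hv : p.val = (τ v).val + 1
    · exact hp v hv
    · have := h v.succ w.succ (by
        rw [insertMin_succ, insertMin_succ, succAbove_val, succAbove_val]
        split_ifs <;> omega) (Fin.succ_lt_succ_iff.2 hlt)
      simpa using this
  · rintro ⟨h, hp⟩ v w
    refine Fin.cases ?_ (fun v => ?_) v
    · intro _ h0
      exact absurd h0 (Fin.not_lt_zero w)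
    refine Fin.cases ?_ (fun w => ?_) w
    · intro h1 _
      rw [insertMin_zero, insertMin_succ, succAbove_val] at h1
      rw [Fin.val_succ]
      refine hp v ?_
      split_ifs at h1 with h2 <;> omega
    · intro h1 h2
      rw [insertMin_succ, insertMin_succ, succAbove_val, succAbove_val] at h1
      rw [Fin.val_succ]
      by_cases h3 : p.val = (τ v).val + 1
      · exact hp v h3
      · refine h v w ?_ (Fin.succ_lt_succ_iff.1 h2)
        split_ifs at h1 <;> omega

/-- The only new pair of consecutive values is `0, 1`, in the wrong order exactly when the old
minimum stands before position `p`. -/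
theorem descentBounded_insertMin {N : ℕ} (D : ℕ → Bool) (p : Fin (N + 1))
    (τ : Equiv.Perm (Fin N)) :
    DescentBounded D (insertMin p τ) ↔
      DescentBounded (fun i => D (i + 1)) τ ∧
        ∀ z : Fin N, z.val = 0 → (τ z).val < p.val → D 1 := by
  constructor
  · intro h
    refine ⟨fun v w hvw hlt => ?_, fun z hz hzp => ?_⟩
    · have := h v.succ w.succ (by simpa using hvw) (by
        rw [insertMin_succ, insertMin_succ]; exact (Fin.strictMono_succAbove p) hlt)
      simpa using this
    · have := h 0 z.succ (by simp [hz]) (by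
        rw [insertMin_succ, insertMin_zero, Fin.lt_def, succAbove_val_lt]; exact hzp)
      simpa [hz] using this
  · rintro ⟨h, hz⟩ v w
    refine Fin.cases ?_ (fun w => ?_) w
    · intro h0; simp at h0
    refine Fin.cases ?_ (fun v => ?_) v
    · intro h0 h1
      rw [insertMin_succ, insertMin_zero, Fin.lt_def, succAbove_val_lt] at h1
      have h0 : w.val = 0 := by simpa using h0
      have := hz w h0 h1
      simpa [h0] using this
    · intro h0 h1
      rw [insertMin_succ, insertMin_succ, (Fin.strictMono_succAbove p).lt_iff_lt] at h1
      rw [Fin.val_succ]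
      exact h v w (by simpa using h0) h1

theorem firstCode_insertMin {N : ℕ} (A : ℕ → Bool) (p : Fin (N + 1)) (τ : Equiv.Perm (Fin N)) :
    firstCode A (insertMin p τ) = countBefore (fun i => A (i + 1)) τ p := by
  rw [firstCode, countBefore]
  symm
  refine Finset.card_bij (fun w _ => w.succ) ?_ ?_ ?_
  · intro w hw
    simp only [Finset.mem_filter, Finset.mem_univ, true_and, Fin.val_succ] at hw ⊢
    exact ⟨hw.1, 0, rfl, Fin.succ_pos w, by
      rw [insertMin_succ, insertMin_zero, Fin.lt_def, succAbove_val_lt]; exact hw.2⟩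
  · intro a _ b _ h
    exact Fin.succ_injective _ h
  · intro w hw
    simp only [Finset.mem_filter, Finset.mem_univ, true_and] at hw
    obtain ⟨h1, z, hz, h2, h3⟩ := hw
    have hz : z = 0 := Fin.ext hz
    subst hz
    obtain ⟨v, rfl⟩ := Fin.exists_succ_eq.2 (Fin.pos_iff_ne_zero.1 h2)
    rw [insertMin_succ, insertMin_zero, Fin.lt_def, succAbove_val_lt] at h3
    exact ⟨v, by simp only [Finset.mem_filter, Finset.mem_univ, true_and]; exact ⟨h1, h3⟩, rfl⟩

theorem countBefore_mono {N : ℕ} (A : ℕ → Bool) (τ : Equiv.Perm (Fin N)) :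
    Monotone (countBefore A τ) := by
  intro p q h
  refine Finset.card_le_card fun w hw => ?_
  simp only [Finset.mem_filter, Finset.mem_univ, true_and] at hw ⊢
  exact ⟨hw.1, hw.2.trans_le h⟩

theorem countBefore_zero {N : ℕ} (A : ℕ → Bool) (τ : Equiv.Perm (Fin N)) :
    countBefore A τ 0 = 0 := by
  simp [countBefore]

theorem countBefore_succ {N : ℕ} (A : ℕ → Bool) (τ : Equiv.Perm (Fin N)) (u : Fin N) :
    countBefore A τ ((τ u).val + 1) = countBefore A τ (τ u) + if A u then 1 else 0 := by
  rw [countBefore, countBefore]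
  split_ifs with h
  · rw [← Finset.card_insert_of_notMem (a := u) (by simp)]
    congr 1
    ext w
    simp only [Finset.mem_filter, Finset.mem_univ, true_and, Finset.mem_insert, Nat.lt_succ_iff_lt_or_eq]
    constructor
    · rintro ⟨h1, h2 | h2⟩
      · exact Or.inr ⟨h1, h2⟩
      · exact Or.inl (τ.injective (Fin.ext h2))
    · rintro (rfl | ⟨h1, h2⟩)
      · exact ⟨h, Or.inr rfl⟩
      · exact ⟨h1, Or.inl h2⟩
  · rw [add_zero]
    congr 1
    ext w
    simp only [Finset.mem_filter, Finset.mem_univ, true_and, Nat.lt_succ_iff_lt_or_eq]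
    constructor
    · rintro ⟨h1, h2 | h2⟩
      · exact ⟨h1, h2⟩
      · rw [τ.injective (Fin.ext h2)] at h1
        exact absurd h1 h
    · rintro ⟨h1, h2⟩
      exact ⟨h1, Or.inl h2⟩

/-- The number of elements of `A` in `[k, N)`. -/
def countFrom (A : ℕ → Bool) (k N : ℕ) : ℕ := ((Finset.Ico k N).filter fun v => A v).card

theorem countBefore_last {N : ℕ} (A : ℕ → Bool) (τ : Equiv.Perm (Fin N)) :
    countBefore A τ N = countFrom A 0 N := by
  rw [countBefore, countFrom]
  refine Finset.card_bij (fun w _ => w.val) ?_ ?_ ?_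
  · intro w hw
    simp only [Finset.mem_filter, Finset.mem_univ, true_and] at hw
    simp [hw.1]
  · intro a _ b _ h; exact Fin.ext h
  · intro v hv
    simp only [Finset.mem_filter, Finset.mem_Ico] at hv
    exact ⟨⟨v, hv.1.2⟩, by simp [hv.2], rfl⟩

theorem countFrom_succ (A : ℕ → Bool) (k N : ℕ) :
    countFrom (fun i => A (i + 1)) k N = countFrom A (k + 1) (N + 1) := by
  rw [countFrom, countFrom]
  refine Finset.card_bij (fun w _ => w + 1) ?_ ?_ ?_
  · intro w hw
    simp only [Finset.mem_filter, Finset.mem_Ico] at hw ⊢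
    exact ⟨⟨by omega, by omega⟩, hw.2⟩
  · intro a _ b _ h; exact Nat.succ_injective h
  · intro v hv
    simp only [Finset.mem_filter, Finset.mem_Ico] at hv
    refine ⟨v - 1, ?_, by omega⟩
    simp only [Finset.mem_filter, Finset.mem_Ico]
    rw [show v - 1 + 1 = v by omega]
    exact ⟨⟨by omega, by omega⟩, hv.2⟩

/-- `countBefore` climbs from `0` in steps of at most one, so the least position with count at least
`b` has count `b` and is either the first or right after a counted value. With
`AllowedPosition.eq_of_countBefore_eq`, allowed positions correspond to codes `0, …, countFrom A 0
N`. -/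
theorem exists_allowedPosition {N : ℕ} (A : ℕ → Bool) (τ : Equiv.Perm (Fin N)) (b : ℕ)
    (hb : b ≤ countFrom A 0 N) :
    ∃ p : Fin (N + 1), AllowedPosition A τ p ∧ countBefore A τ p = b := by
  have hex : ∃ p, b ≤ countBefore A τ p := ⟨N, by rwa [countBefore_last]⟩
  classical
  have hle : Nat.find hex ≤ N := Nat.find_min' hex (by rwa [countBefore_last])
  refine ⟨⟨Nat.find hex, by omega⟩, ?_⟩
  have h1 := Nat.find_spec hex
  have h2 : ∀ m, m < Nat.find hex → countBefore A τ m < b := fun m hm =>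
    not_le.1 (Nat.find_min hex hm)
  dsimp only
  generalize Nat.find hex = p at h1 h2 hle
  constructor
  · rintro u rfl
    rw [countBefore_succ] at h1
    have := h2 _ (Nat.lt_succ_self _)
    by_contra hA
    rw [if_neg hA] at h1
    omega
  · cases p with
    | zero => rw [countBefore_zero] at h1 ⊢; omega
    | succ p =>
      have h3 := h2 p (Nat.lt_succ_self _)
      obtain ⟨u, hu⟩ := τ.surjective ⟨p, hle⟩
      have h4 := countBefore_succ A τ u
      rw [hu] at h4
      dsimp only at h4
      split_ifs at h4 <;> omega

theorem AllowedPosition.countBefore_lt {N : ℕ} {A : ℕ → Bool} {τ : Equiv.Perm (Fin N)} {p q : ℕ}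
    (hq : AllowedPosition A τ q) (hqN : q ≤ N) (h : p < q) :
    countBefore A τ p < countBefore A τ q := by
  obtain ⟨q, rfl⟩ : ∃ r, q = r + 1 := ⟨q - 1, by omega⟩
  obtain ⟨u, hu⟩ := τ.surjective ⟨q, hqN⟩
  have h4 := countBefore_succ A τ u
  rw [if_pos (hq u (by rw [hu])), hu] at h4
  have := countBefore_mono A τ (Nat.lt_succ_iff.1 h)
  dsimp only at h4
  omega

theorem AllowedPosition.eq_of_countBefore_eq {N : ℕ} {A : ℕ → Bool} {τ : Equiv.Perm (Fin N)}
    {p q : ℕ} (hp : AllowedPosition A τ p) (hpN : p ≤ N) (hq : AllowedPosition A τ q)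
    (hqN : q ≤ N) (h : countBefore A τ p = countBefore A τ q) : p = q := by
  rcases lt_trichotomy p q with h' | h' | h'
  · exact absurd h (hq.countBefore_lt hqN h').ne
  · exact h'
  · exact absurd h (hp.countBefore_lt hpN h').ne'

/-- The relative order of the old and the new minimum can be read off from their codes. If `p` lies
to the right of the old minimum, the value right before `p` is in `A` and is counted for `p` but not
for the old minimum, whence the strict inequality. -/
theorem AllowedPosition.firstCode_lt_iff {N : ℕ} {A : ℕ → Bool} {τ : Equiv.Perm (Fin N)}
    {p : ℕ} (hp : AllowedPosition A τ p) (hpN : p ≤ N) :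
    firstCode A τ < countBefore A τ p ↔ ∃ z : Fin N, z.val = 0 ∧ (τ z).val < p := by
  constructor
  · intro h
    by_contra! hz
    refine absurd h (not_lt.2 (Finset.card_le_card fun w hw => ?_))
    simp only [Finset.mem_filter, Finset.mem_univ, true_and] at hw ⊢
    have hN : 0 < N := w.pos
    have h0 := hz ⟨0, hN⟩ rfl
    refine ⟨hw.1, ⟨0, hN⟩, rfl, ?_, ?_⟩
    · rw [Fin.lt_def]
      by_contra hw0
      have : w = ⟨0, hN⟩ := Fin.ext (by simpa using hw0)
      rw [this] at hw
      omega
    · rw [Fin.lt_def]; omega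
  · rintro ⟨z, hz, hzp⟩
    obtain ⟨q, rfl⟩ : ∃ r, p = r + 1 := ⟨p - 1, by omega⟩
    obtain ⟨u, hu⟩ := τ.surjective ⟨q, hpN⟩
    refine Finset.card_lt_card (Finset.ssubset_iff_of_subset ?_ |>.2 ⟨u, ?_, ?_⟩)
    · intro w hw
      simp only [Finset.mem_filter, Finset.mem_univ, true_and] at hw ⊢
      obtain ⟨h1, y, hy, -, h2⟩ := hw
      rw [show y = z from Fin.ext (hy.trans hz.symm), Fin.lt_def] at h2
      exact ⟨h1, by omega⟩
    · simp [hp u (by rw [hu]), hu]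
    · simp only [Finset.mem_filter, Finset.mem_univ, true_and, not_and, not_exists]
      rintro - y hy - h
      rw [show y = z from Fin.ext (hy.trans hz.symm), Fin.lt_def, hu] at h
      dsimp only at h
      omega

theorem countBefore_le {N : ℕ} (A : ℕ → Bool) (τ : Equiv.Perm (Fin N)) (p : Fin (N + 1)) :
    countBefore A τ p ≤ countFrom A 0 N := by
  rw [← countBefore_last A τ]
  exact countBefore_mono A τ (Nat.lt_succ_iff.1 p.isLt)

theorem insertMin_mem_boundedPerms {N : ℕ} {A D : ℕ → Bool} {p : Fin (N + 1)}
    {τ : Equiv.Perm (Fin N)} :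
    insertMin p τ ∈ boundedPerms (N + 1) A D ↔
      τ ∈ boundedPerms N (fun i => A (i + 1)) (fun i => D (i + 1)) ∧
        AllowedPosition (fun i => A (i + 1)) τ p ∧
        (firstCode (fun i => A (i + 1)) τ < countBefore (fun i => A (i + 1)) τ p → D 1) := by
  simp only [boundedPerms, Finset.mem_filter, Finset.mem_univ, true_and,
    genocchiBounded_insertMin, descentBounded_insertMin]
  constructor
  · rintro ⟨⟨h1, h2⟩, h3, h4⟩
    refine ⟨⟨h1, h3⟩, h2, ?_⟩
    rw [h2.firstCode_lt_iff (Nat.lt_succ_iff.1 p.isLt)]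
    rintro ⟨z, hz, hzp⟩
    exact h4 z hz hzp
  · rintro ⟨⟨h1, h3⟩, h2, h4⟩
    rw [h2.firstCode_lt_iff (Nat.lt_succ_iff.1 p.isLt)] at h4
    exact ⟨⟨h1, h2⟩, h3, fun z hz hzp => h4 ⟨z, hz, hzp⟩⟩

/-- Removing the smallest value from the permutations with a given code. -/
theorem card_filter_firstCode (N : ℕ) (A D : ℕ → Bool) (b : ℕ) :
    ((boundedPerms (N + 1) A D).filter fun π => firstCode A π = b).card =
      if b ≤ countFrom A 1 (N + 1) then
        ((boundedPerms N (fun i => A (i + 1)) (fun i => D (i + 1))).filter fun τ =>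
          firstCode (fun i => A (i + 1)) τ < b → D 1).card
      else 0 := by
  rw [← countFrom_succ]
  split_ifs with hb
  -- The bijection inserts the minimum at the unique allowed position with code `b`.
  · choose pos hpos1 hpos2 using fun τ : Equiv.Perm (Fin N) =>
      exists_allowedPosition (fun i => A (i + 1)) τ b hb
    symm
    refine Finset.card_bij (fun τ _ => insertMin (pos τ) τ) ?_ ?_ ?_
    · intro τ hτ
      rw [Finset.mem_filter] at hτ ⊢
      rw [insertMin_mem_boundedPerms, firstCode_insertMin, hpos2]
      exact ⟨⟨hτ.1, hpos1 τ, hτ.2⟩, rfl⟩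
    · intro τ _ ρ _ h
      have hp : pos τ = pos ρ := by rw [← insertMin_zero (pos τ) τ, h, insertMin_zero]
      ext v
      have := congrArg (fun f => f v.succ) h
      simp only [insertMin_succ, hp] at this
      rw [Fin.succAbove_right_injective this]
    · intro π hπ
      obtain ⟨p, τ, rfl⟩ := insertMin_surjective π
      rw [Finset.mem_filter, insertMin_mem_boundedPerms, firstCode_insertMin] at hπ
      obtain ⟨⟨h1, h2, h3⟩, h4⟩ := hπ
      rw [h4] at h3
      refine ⟨τ, Finset.mem_filter.2 ⟨h1, h3⟩, ?_⟩
      have : pos τ = p := Fin.ext ((hpos1 τ).eq_of_countBefore_eq (Nat.lt_succ_iff.1 (pos τ).isLt)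
        h2 (Nat.lt_succ_iff.1 p.isLt) ((hpos2 τ).trans h4.symm))
      rw [this]
  · rw [Finset.card_eq_zero, Finset.filter_eq_empty_iff]
    rintro π - h
    obtain ⟨p, τ, rfl⟩ := insertMin_surjective π
    rw [firstCode_insertMin] at h
    exact hb (h ▸ countBefore_le _ τ p)

theorem boundedPerms_congr {N : ℕ} {A B D E : ℕ → Bool} (hA : ∀ v, 0 < v → v < N → A v = B v)
    (hD : ∀ v, 0 < v → v < N → D v = E v) : boundedPerms N A D = boundedPerms N B E := by
  rw [boundedPerms, boundedPerms]
  refine Finset.filter_congr fun π _ => and_congr ?_ ?_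
  · refine forall₂_congr fun v w => imp_congr_right fun _ => imp_congr_right fun h => ?_
    rw [hA v ((Nat.zero_le _).trans_lt (Fin.lt_def.1 h)) v.isLt]
  · refine forall₂_congr fun v w => imp_congr_right fun h => imp_congr_right fun _ => ?_
    rw [hD w (by omega) w.isLt]

theorem card_boundedPerms_zero (A D : ℕ → Bool) : (boundedPerms 0 A D).card = 1 := by
  rw [boundedPerms, Finset.filter_true_of_mem]
  · simp
  · intro π _
    exact ⟨fun v => v.elim0, fun v => v.elim0⟩

theorem sum_range_add_choose (k r : ℕ) :
    ∑ j ∈ Finset.range r, (k + j).choose k = (k + r).choose (k + 1) := by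
  induction r with
  | zero => simp
  | succ r ih =>
    rw [Finset.sum_range_succ, ih, ← add_assoc, Nat.choose_succ_succ' (k + r) k, add_comm]

theorem countFrom_anti (A : ℕ → Bool) {k l : ℕ} (h : k ≤ l) (N : ℕ) :
    countFrom A l N ≤ countFrom A k N := by
  refine Finset.card_le_card fun v hv => ?_
  simp only [Finset.mem_filter, Finset.mem_Ico] at hv ⊢
  exact ⟨⟨by omega, hv.1.2⟩, hv.2⟩

/-- The hockey-stick identity, which lengthens a block by one value. For `b > f` truncated
subtraction leaves `k.choose (k + 1) = 0`. -/
theorem card_filter_le_of_card_filter_eq {α : Type*} (s : Finset α) (q : α → ℕ) (T k f : ℕ)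
    (h : ∀ b, (s.filter fun x => q x = b).card = if b ≤ f then T * (k + (f - b)).choose k else 0)
    (b : ℕ) : (s.filter fun x => b ≤ q x).card = T * (k + (f + 1 - b)).choose (k + 1) := by
  have hmaps : ∀ x ∈ s.filter fun x => b ≤ q x, q x ∈ Finset.Ico b (f + 1) := by
    intro x hx
    rw [Finset.mem_filter] at hx
    rw [Finset.mem_Ico]
    refine ⟨hx.2, ?_⟩
    by_contra hlt
    have := h (q x)
    rw [if_neg (by omega), Finset.card_eq_zero, Finset.filter_eq_empty_iff] at this
    exact this hx.1 rfl
  rw [Finset.card_eq_sum_card_fiberwise hmaps]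
  have h1 : ∀ c ∈ Finset.Ico b (f + 1), ((s.filter fun x => b ≤ q x).filter fun x => q x = c).card =
      T * (k + (f - c)).choose k := by
    intro c hc
    rw [Finset.mem_Ico] at hc
    rw [Finset.filter_filter, ← if_pos (show c ≤ f by omega) (t := T * (k + (f - c)).choose k)
      (e := 0), ← h c]
    congr 1
    refine Finset.filter_congr fun x _ => ⟨fun hx => hx.2, fun hx => ⟨by omega, hx⟩⟩
  rw [Finset.sum_congr rfl h1, ← Finset.mul_sum, ← sum_range_add_choose]
  congr 1
  rw [← Nat.Ico_zero_eq_range]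
  rcases le_or_gt b (f + 1) with hb | hb
  · have := Finset.sum_Ico_reflect (fun j => (k + j).choose k) b (m := f + 1) (n := f) (le_refl _)
    rw [this]
    congr 2; omega
  · rw [Finset.Ico_eq_empty (by omega), show f + 1 - b = 0 by omega]; simp

/-- The distribution of the code of the first letter of a block of `k + 1` increasing letters. -/
theorem card_filter_firstCode_block (m k : ℕ) (A D : ℕ → Bool)
    (hD : ∀ i, 0 < i → i ≤ k → D i = false) (hDk : D (k + 1) = true) (b : ℕ) :
    ((boundedPerms (m + k + 1) A D).filter fun π => firstCode A π = b).card =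
      if b ≤ countFrom A (k + 1) (m + k + 1) then
        (boundedPerms m (fun i => A (i + (k + 1))) fun i => D (i + (k + 1))).card *
          (k + (countFrom A (k + 1) (m + k + 1) - b)).choose k
      else 0 := by
  induction k generalizing A D b with
  | zero =>
    have hDk : D 1 = true := hDk
    simp [card_filter_firstCode, hDk]
  | succ k ih =>
    -- As `D 1` is false, the code of the next value must be at least `b`: a tail of the
    -- distribution for the shorter block.
    rw [card_filter_firstCode, hD 1 (by omega) (by omega)]
    have h := card_filter_le_of_card_filter_eq _ _ _ _ _
      (ih (fun i => A (i + 1)) (fun i => D (i + 1)) (fun i h1 h2 => hD _ (by omega) (by omega))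
        hDk) b
    simp only [countFrom_succ] at h
    simp only [Bool.false_eq_true, imp_false, not_lt]
    have hle := countFrom_anti A (show 1 ≤ k + 1 + 1 by omega) (m + (k + 1) + 1)
    change _ = if b ≤ countFrom A (k + 1 + 1) (m + k + 1 + 1) then _ else _
    change countFrom A (k + 1 + 1) (m + k + 1 + 1) ≤ countFrom A 1 (m + k + 1 + 1) at hle
    change (if b ≤ countFrom A 1 (m + k + 1 + 1) then _ else _) = _
    split_ifs with h1 h2 h2
    · refine h.trans ?_
      simp only [add_assoc]
      congr 2
      simp only [add_assoc] at h2 ⊢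
      omega
    · refine h.trans ?_
      rw [Nat.choose_eq_zero_of_lt (by omega), mul_zero]
    · omega
    · rfl

theorem card_boundedPerms_block (m k : ℕ) (A D : ℕ → Bool)
    (hD : ∀ i, 0 < i → i ≤ k → D i = false) (hDk : D (k + 1) = true) :
    (boundedPerms (m + k + 1) A D).card =
      (boundedPerms m (fun i => A (i + (k + 1))) fun i => D (i + (k + 1))).card *
        (k + 1 + countFrom A (k + 1) (m + k + 1)).choose (k + 1) := by
  have h := card_filter_le_of_card_filter_eq _ _ _ _ _
    (card_filter_firstCode_block m k A D hD hDk) 0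
  rw [Finset.filter_true_of_mem fun _ _ => Nat.zero_le _] at h
  rw [h]
  congr 2
  omega

/-! ### The counts are the coefficients of the products -/

/-- The indicator function of the partial sums of a list (without the empty sum). -/
def isPartialSum : List ℕ → ℕ → Bool
  | [], _ => false
  | n :: I, i => decide (i = n) || (decide (n < i) && isPartialSum I (i - n))

theorem isPartialSum_iff {I : List ℕ} (hI : ∀ i ∈ I, 0 < i) {i : ℕ} :
    isPartialSum I i = true ↔ ∃ j, 0 < j ∧ j ≤ I.length ∧ (I.take j).sum = i := by
  induction I generalizing i with
  | nil => simp [isPartialSum]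
  | cons n I ih =>
    simp only [isPartialSum, Bool.or_eq_true, decide_eq_true_eq, Bool.and_eq_true]
    have hI' : ∀ i ∈ I, 0 < i := fun i hi => hI i (by simp [hi])
    rw [ih hI']
    constructor
    · rintro (rfl | ⟨h1, j, h2, h3, h4⟩)
      · exact ⟨1, by simp⟩
      · refine ⟨j + 1, by omega, by simpa using h3, ?_⟩
        rw [List.take_succ_cons, List.sum_cons, h4]; omega
    · rintro ⟨j, h1, h2, h3⟩
      obtain ⟨j, rfl⟩ : ∃ k, j = k + 1 := ⟨j - 1, by omega⟩
      rw [List.take_succ_cons, List.sum_cons] at h3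
      rcases Nat.eq_zero_or_pos j with rfl | hj
      · left; simpa using h3.symm
      · right
        have hj2 : j ≤ I.length := by simpa using h2
        refine ⟨?_, j, hj, hj2, by omega⟩
        have : 0 < (I.take j).sum := by
          cases I with
          | nil => simp at hj2; omega
          | cons a I =>
            obtain ⟨j, rfl⟩ : ∃ k, j = k + 1 := ⟨j - 1, by omega⟩
            rw [List.take_succ_cons, List.sum_cons]
            have := hI' a (by simp)
            omega
        omega

/-- The letter of a word corresponding to the boundary `v`. -/
def wordBoundary (y : List Bool) (v : ℕ) : Bool := y[v - 1]?.getD false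

theorem countFrom_add (A : ℕ → Bool) (n m : ℕ) :
    countFrom A n (m + n) = countFrom (fun i => A (i + n)) 0 m := by
  induction n generalizing A with
  | zero => rfl
  | succ n ih =>
    rw [← add_assoc, ← countFrom_succ, ih]
    rfl

theorem countFrom_getElem (z : List Bool) (m : ℕ) :
    countFrom (fun v => z[v]?.getD false) 0 m = (z.take m).count true := by
  induction m with
  | zero => simp [countFrom]
  | succ m ih =>
    rw [countFrom, ← Finset.insert_Ico_right_eq_Ico_add_one (Nat.zero_le m), Finset.filter_insert,
      List.take_add_one, List.count_append, ← ih, countFrom]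
    rcases h : z[m]? with _ | _ | _ <;> simp

/-- The extra `1` is the last boundary `n + m`, outside the range of `countFrom`; it cancels the `-
1` in `wordCoeff`. -/
theorem countFrom_wordBoundary {y : List Bool} {n m : ℕ} (hn : 0 < n) (hy : y.length = n + m)
    (hlast : wordBoundary y (n + m) = true) :
    (y.drop (n - 1)).count true = countFrom (wordBoundary y) n (m + n) + 1 := by
  have h1 : (fun i => wordBoundary y (i + n)) = fun i => (y.drop (n - 1))[i]?.getD false := by
    funext i
    rw [wordBoundary, List.getElem?_drop, show i + n - 1 = n - 1 + i by omega]
  have hz : (y.drop (n - 1)).length = m + 1 := by simp; omega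
  have hlast' : (y.drop (n - 1))[m]? = some true := by
    rw [wordBoundary, show n + m - 1 = n - 1 + m by omega] at hlast
    rw [List.getElem?_drop]
    rcases h : y[n - 1 + m]? with _ | _ | _ <;> simp [h] at hlast ⊢
  rw [countFrom_add, h1, countFrom_getElem]
  have h2 := List.take_add_one (l := y.drop (n - 1)) (i := m)
  rw [List.take_of_length_le hz.le, hlast'] at h2
  conv_lhs => rw [h2, List.count_append]
  simp

/-- The coefficients of a product of complete functions count permutations. -/
theorem card_boundedPerms_eq_wordCoeff (I : List ℕ) (hI : ∀ i ∈ I, 0 < i) (y : List Bool)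
    (hy : y.length = I.sum) (hlast : y ≠ [] → wordBoundary y I.sum = true) :
    (boundedPerms I.sum (wordBoundary y) (isPartialSum I)).card = wordCoeff I y := by
  induction I generalizing y with
  | nil => exact card_boundedPerms_zero _ _
  | cons n I ih =>
    obtain ⟨k, rfl⟩ : ∃ k, n = k + 1 := ⟨n - 1, by have := hI n (by simp); omega⟩
    rw [List.sum_cons] at hy hlast
    have hne : y ≠ [] := by rintro rfl; simp at hy; omega
    have hlast := hlast hne
    have hcount := countFrom_wordBoundary (Nat.succ_pos k) hy hlast
    have hblock := card_boundedPerms_block I.sum k (wordBoundary y) (isPartialSum ((k + 1) :: I))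
      (fun i h1 h2 => by simp [isPartialSum]; omega) (by simp [isPartialSum])
    rw [wordCoeff, hcount, List.sum_cons, add_comm (k + 1) I.sum, ← add_assoc I.sum, hblock,
      mul_comm]
    congr 1
    rw [← ih (fun i hi => hI i (by simp [hi])) (y.drop (k + 1)) (by simp; omega)]
    · congr 1
      -- The shifted functions may differ at `0`, but no condition looks at this value.
      apply boundedPerms_congr
      · intro v h1 h2
        rw [wordBoundary, wordBoundary, List.getElem?_drop]
        congr 2; omega
      · intro v h1 h2
        simp [isPartialSum, h1.ne']
        intro h; omega
    · intro h
      have h0 : I.sum ≠ 0 := by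
        intro h0
        exact h (List.drop_eq_nil_of_le (by omega))
      rw [wordBoundary] at hlast ⊢
      rw [List.getElem?_drop, ← hlast]
      congr 2; omega

/-- The factor of the last part `n` of `I` sees only the final letter `false`, hence is `(n -
1).choose n = 0`. -/
theorem wordCoeff_eq_zero (I : List ℕ) (hI : ∀ i ∈ I, 0 < i) (y : List Bool)
    (hy : y.length = I.sum) (hne : y ≠ []) (hlast : wordBoundary y I.sum = false) :
    wordCoeff I y = 0 := by
  induction I generalizing y with
  | nil => simp at hy; exact absurd hy hne
  | cons n I ih =>
    obtain ⟨k, rfl⟩ : ∃ k, n = k + 1 := ⟨n - 1, by have := hI n (by simp); omega⟩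
    rw [List.sum_cons] at hy hlast
    rw [wordCoeff]
    by_cases h : y.drop (k + 1) = []
    · have h1 : I.sum = 0 := by
        have := congrArg List.length h
        simp at this; omega
      have h2 : y.drop k = [false] := by
        rw [wordBoundary, h1] at hlast
        have h3 : k < y.length := by omega
        rw [List.drop_eq_getElem_cons h3, h]
        simpa [h3] using hlast
      rw [Nat.add_sub_cancel, h2]
      simp
    · rw [ih (fun i hi => hI i (by simp [hi])) _ (by simp; omega) h, mul_zero]
      rw [wordBoundary] at hlast ⊢
      have : I.sum ≠ 0 := by
        intro h0
        exact h (List.drop_eq_nil_of_le (by omega))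
      rw [List.getElem?_drop, ← hlast]
      congr 2; omega

/-! ### Compositions as words, and descent sets as bounds -/

noncomputable section

/-- The word of length `i₁ + ⋯ + i_r` with the letter `true` at the partial sums. -/
def listWord : List ℕ → List Bool
  | [] => []
  | n :: I => List.replicate (n - 1) false ++ true :: listWord I

theorem wordParts_listWord {I : List ℕ} (hI : ∀ i ∈ I, 0 < i) : wordParts 0 (listWord I) = I := by
  induction I with
  | nil => rfl
  | cons n I ih =>
    have := hI n (by simp)
    rw [listWord, wordParts_replicate_append, wordParts, ih fun i hi => hI i (by simp [hi])]
    congr 1; omega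

theorem length_listWord {I : List ℕ} (hI : ∀ i ∈ I, 0 < i) : (listWord I).length = I.sum := by
  induction I with
  | nil => rfl
  | cons n I ih =>
    have := hI n (by simp)
    simp [listWord, ih fun i hi => hI i (by simp [hi])]
    omega

theorem getElem_listWord {I : List ℕ} (hI : ∀ i ∈ I, 0 < i) (i : ℕ) :
    (listWord I)[i]?.getD false = isPartialSum I (i + 1) := by
  induction I generalizing i with
  | nil => simp [listWord, isPartialSum]
  | cons n I ih =>
    have hn := hI n (by simp)
    rw [listWord, isPartialSum]
    rcases lt_trichotomy i (n - 1) with h | h | h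
    · rw [List.getElem?_append_left (by simpa using h), List.getElem?_replicate_of_lt h,
        decide_eq_false (by omega), decide_eq_false (by omega)]
      rfl
    · rw [List.getElem?_append_right (by simpa using h.ge)]
      simp [h]
      omega
    · rw [List.getElem?_append_right (by simpa using h.le), List.length_replicate,
        show i - (n - 1) = i - n + 1 by omega, List.getElem?_cons_succ,
        ih fun i hi => hI i (by simp [hi]), decide_eq_false (by omega), decide_eq_true (by omega),
        show i - n + 1 = i + 1 - n by omega]
      rfl

theorem wordParts_pos (c : ℕ) (x : List Bool) : ∀ i ∈ wordParts c x, 0 < i := by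
  induction x generalizing c with
  | nil => simp [wordParts]
  | cons b x ih =>
    cases b
    · exact ih _
    · intro i hi
      rw [wordParts, List.mem_cons] at hi
      rcases hi with rfl | hi
      · omega
      · exact ih _ i hi

theorem listWord_wordParts (c : ℕ) (y : List Bool) (h : y.getLast? = some true) :
    listWord (wordParts c y) = List.replicate c false ++ y := by
  induction y generalizing c with
  | nil => simp at h
  | cons b y ih =>
    cases b
    · cases y with
      | nil => simp at h
      | cons a y =>
        rw [wordParts, ih (c + 1) (by simpa using h), List.replicate_succ']
        simp
    · cases y with
      | nil => simp [wordParts, listWord]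
      | cons a y =>
        rw [wordParts, listWord, ih 0 (by simpa using h)]
        simp

theorem wordBoundary_listWord {I : List ℕ} (hI : ∀ i ∈ I, 0 < i) {v : ℕ} (hv : 0 < v) :
    wordBoundary (listWord I) v = isPartialSum I v := by
  rw [wordBoundary, getElem_listWord hI, Nat.sub_add_cancel hv]

theorem Composition.blocks_forall_pos {n : ℕ} (J : Composition n) : ∀ i ∈ J.blocks, 0 < i :=
  fun _ h => J.blocks_pos h

theorem Composition.isPartialSum_blocks {n : ℕ} (J : Composition n) {v : Fin (n + 1)}
    (hv : 0 < v.val) : isPartialSum J.blocks v = true ↔ v ∈ J.boundaries := by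
  rw [isPartialSum_iff J.blocks_forall_pos, Composition.boundaries, Finset.mem_map]
  constructor
  · rintro ⟨j, -, h1, h2⟩
    exact ⟨⟨j, Nat.lt_succ_of_le h1⟩, Finset.mem_univ _, Fin.ext h2⟩
  · rintro ⟨j, -, rfl⟩
    refine ⟨j, ?_, Nat.le_of_lt_succ j.isLt, rfl⟩
    by_contra h0
    have : j = 0 := Fin.ext (by simpa using h0)
    subst this
    simp at hv

/-- A sum over words is a sum over compositions if the words that do not end in `true` contribute
nothing. -/
theorem wordSum_eq_sum_composition {M : Type*} [AddCommMonoid M] (n : ℕ) (F : List Bool → M)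
    (hF : ∀ y : List Bool, y.length = n → y ≠ [] → wordBoundary y n = false → F y = 0) :
    wordSum n F = ∑ J : Composition n, F (listWord J.blocks) := by
  have hlen : ∀ J : Composition n, (listWord J.blocks).length = n := fun J => by
    rw [length_listWord J.blocks_forall_pos, J.blocks_sum]
  have hofFn : ∀ J : Composition n,
      List.ofFn (fun i : Fin n => (listWord J.blocks)[i.val]?.getD false) = listWord J.blocks := by
    intro J
    apply List.ext_getElem (by simp [hlen])
    intro i h1 h2
    simp [h2]
  symm
  refine Finset.sum_of_injOn (fun J i => (listWord J.blocks)[i.val]?.getD false) ?_ ?_ ?_ ?_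
  · intro J _ J' _ h
    have h' := congrArg List.ofFn h
    dsimp only at h'
    rw [hofFn, hofFn] at h'
    have := congrArg (wordParts 0) h'
    rw [wordParts_listWord J.blocks_forall_pos, wordParts_listWord J'.blocks_forall_pos] at this
    exact Composition.ext this
  · intro J _
    simp
  · intro v _ hv
    by_contra hne
    apply hv
    have hy : (List.ofFn v).length = n := by simp
    have hword : listWord (wordParts 0 (List.ofFn v)) = List.ofFn v := by
      by_cases h0 : List.ofFn v = []
      · rw [h0]; rfl
      · rw [listWord_wordParts]
        · simp
        · have hb : wordBoundary (List.ofFn v) n = true := by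
            by_contra hb
            exact hne (hF _ hy h0 (by simpa using hb))
          rw [List.getLast?_eq_getElem?, hy]
          rw [wordBoundary] at hb
          rcases h : (List.ofFn v)[n - 1]? with _ | _ | _ <;> simp [h] at hb ⊢
    have hpos := wordParts_pos 0 (List.ofFn v)
    refine ⟨⟨wordParts 0 (List.ofFn v), fun {i} hi => hpos i hi, ?_⟩, by simp, ?_⟩
    · rw [← length_listWord hpos, hword, hy]
    · funext i
      dsimp only
      rw [hword]
      simp
  · intro J _
    rw [hofFn]

theorem mem_boundaries_compositionOfDescents {n : ℕ} {D : Finset ℕ} {i : Fin (n + 1)} :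
    i ∈ (compositionOfDescents n D).boundaries ↔ i = 0 ∨ i = Fin.last n ∨ i.val ∈ D := by
  rw [compositionOfDescents, CompositionAsSet.toComposition_boundaries]
  simp

theorem Composition.zero_mem_boundaries {n : ℕ} (J : Composition n) : 0 ∈ J.boundaries :=
  J.toCompositionAsSet.zero_mem

theorem Composition.last_mem_boundaries {n : ℕ} (J : Composition n) :
    Fin.last n ∈ J.boundaries :=
  J.toCompositionAsSet.getLast_mem

theorem boundaries_compositionOfDescents_subset {n : ℕ} {D : Finset ℕ} {J : Composition n} :
    (compositionOfDescents n D).boundaries ⊆ J.boundaries ↔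
      ∀ v ∈ D, 0 < v → v < n → isPartialSum J.blocks v = true := by
  constructor
  · intro h v hv h0 hn
    have := h (mem_boundaries_compositionOfDescents (i := ⟨v, by omega⟩).2 (Or.inr (Or.inr hv)))
    exact (J.isPartialSum_blocks (v := ⟨v, by omega⟩) h0).2 this
  · intro h i hi
    rw [mem_boundaries_compositionOfDescents] at hi
    rcases hi with rfl | rfl | hi
    · exact J.zero_mem_boundaries
    · exact J.last_mem_boundaries
    · by_cases h0 : i = 0
      · rw [h0]; exact J.zero_mem_boundaries
      by_cases hl : i = Fin.last n
      · rw [hl]; exact J.last_mem_boundaries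
      have h0' : 0 < i.val := Nat.pos_of_ne_zero fun h => h0 (Fin.ext h)
      have hl' : i.val < n :=
        lt_of_le_of_ne (Nat.le_of_lt_succ i.isLt) fun h => hl (Fin.ext h)
      exact (J.isPartialSum_blocks h0').1 (h _ hi h0' hl')

theorem descentComposition_boundaries_subset {n : ℕ} (π : Equiv.Perm (Fin n)) (I : Composition n) :
    (descentComposition π).boundaries ⊆ I.boundaries ↔
      DescentBounded (isPartialSum I.blocks) π := by
  rw [descentComposition, boundaries_compositionOfDescents_subset]
  simp only [descentPositions, Finset.mem_image, Finset.mem_filter, Finset.mem_univ, true_and]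
  constructor
  · intro h v w hw hlt
    exact h w ⟨v, ⟨w, hw, hlt⟩, hw.symm⟩ (by omega) w.isLt
  · rintro h _ ⟨v, ⟨w, hw, hlt⟩, rfl⟩ - -
    rw [← hw]
    exact h v w hw hlt

/-- The `- 1` in the Genocchi composition compensates for numbering values from `0`: a descent from
value `v` gives the boundary `v`. Being the top of a descent, `v` is not `0`. -/
theorem genocchiComposition_boundaries_subset {n : ℕ} (π : Equiv.Perm (Fin n))
    (J : Composition n) :
    (genocchiComposition π⁻¹).boundaries ⊆ J.boundaries ↔
      GenocchiBounded (isPartialSum J.blocks) π := by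
  rw [genocchiComposition, boundaries_compositionOfDescents_subset]
  simp only [genocchiDescents, Finset.mem_image, Finset.mem_filter, Finset.mem_univ, true_and]
  constructor
  · intro h v w hw hlt
    refine h v ⟨v.val + 1, ⟨π v, ⟨π w, hw, ?_⟩, ?_⟩, by omega⟩ ?_ v.isLt
    · simpa using hlt
    · simp
    · exact (Nat.zero_le _).trans_lt (Fin.lt_def.1 hlt)
  · rintro h _ ⟨_, ⟨i, ⟨j, hj, hlt⟩, rfl⟩, rfl⟩ - -
    exact h (π⁻¹ i) (π⁻¹ j) (by simpa using hj) hlt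

/-- Permutations with prescribed bounds on the two statistics. -/
theorem card_filter_boundaries_subset {n : ℕ} (I J : Composition n) :
    (Finset.univ.filter fun σ : Equiv.Perm (Fin n) =>
      (descentComposition σ⁻¹).boundaries ⊆ I.boundaries ∧
        (genocchiComposition σ).boundaries ⊆ J.boundaries).card =
      wordCoeff I.blocks (listWord J.blocks) := by
  have h1 : (Finset.univ.filter fun σ : Equiv.Perm (Fin n) =>
      (descentComposition σ⁻¹).boundaries ⊆ I.boundaries ∧
        (genocchiComposition σ).boundaries ⊆ J.boundaries).card =
      (boundedPerms n (isPartialSum J.blocks) (isPartialSum I.blocks)).card := by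
    refine Finset.card_bij (fun σ _ => σ⁻¹) ?_ ?_ ?_
    · intro σ hσ
      rw [Finset.mem_filter, descentComposition_boundaries_subset] at hσ
      rw [boundedPerms, Finset.mem_filter, ← genocchiComposition_boundaries_subset, inv_inv]
      exact ⟨Finset.mem_univ _, hσ.2.2, hσ.2.1⟩
    · intro σ _ τ _ h
      exact inv_injective h
    · intro π hπ
      rw [boundedPerms, Finset.mem_filter, ← genocchiComposition_boundaries_subset] at hπ
      refine ⟨π⁻¹, ?_, inv_inv π⟩
      rw [Finset.mem_filter, descentComposition_boundaries_subset, inv_inv]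
      exact ⟨Finset.mem_univ _, hπ.2.2, hπ.2.1⟩
  have h2 := card_boundedPerms_eq_wordCoeff I.blocks I.blocks_forall_pos (listWord J.blocks)
    (by rw [length_listWord J.blocks_forall_pos, I.blocks_sum, J.blocks_sum]) (by
      intro hne
      have hn : 0 < n := by
        have := List.length_pos_iff.2 hne
        rwa [length_listWord J.blocks_forall_pos, J.blocks_sum] at this
      rw [I.blocks_sum, wordBoundary_listWord J.blocks_forall_pos hn]
      exact (J.isPartialSum_blocks (v := Fin.last n) hn).2 J.last_mem_boundaries)
  rw [h1, ← h2]
  have h3 : ∀ m, m = n → (boundedPerms n (isPartialSum J.blocks) (isPartialSum I.blocks)).card =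
      (boundedPerms m (wordBoundary (listWord J.blocks)) (isPartialSum I.blocks)).card := by
    rintro m rfl
    congr 1
    exact boundedPerms_congr
      (fun v hv _ => (wordBoundary_listWord J.blocks_forall_pos hv).symm) fun _ _ _ => rfl
  exact h3 _ I.blocks_sum

/-! ### Möbius inversion and linear independence -/

/-- An alternating sum over an interval of the lattice of compositions. -/
theorem sum_compositions_neg_one_pow {R : Type*} [Ring R] {n : ℕ} (I J : Composition n) :
    ∑ C : Composition n with J.boundaries ⊆ C.boundaries ∧ C.boundaries ⊆ I.boundaries,
      (-1 : R) ^ (I.length - C.length) = if J = I then 1 else 0 := by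
  have hbd : ∀ C C' : Composition n, C.boundaries = C'.boundaries → C = C' := fun C C' h =>
    (compositionEquiv n).injective (CompositionAsSet.ext h)
  by_cases hJI : J.boundaries ⊆ I.boundaries
  · have h1 : ∑ C : Composition n with J.boundaries ⊆ C.boundaries ∧ C.boundaries ⊆ I.boundaries,
        (-1 : ℤ) ^ (I.length - C.length) =
        ∑ s ∈ (I.boundaries \ J.boundaries).powerset, (-1 : ℤ) ^ s.card := by
      -- Complements in `I.boundaries` identify the interval with a full power set, and the sign
      -- with the parity of the subset.
      refine Finset.sum_bij (fun C _ => I.boundaries \ C.boundaries) ?_ ?_ ?_ ?_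
      · intro C hC
        simp only [Finset.mem_filter, Finset.mem_univ, true_and] at hC
        exact Finset.mem_powerset.2 (Finset.sdiff_subset_sdiff le_rfl hC.1)
      · intro C hC C' hC' h
        simp only [Finset.mem_filter, Finset.mem_univ, true_and] at hC hC'
        apply hbd
        rw [← Finset.sdiff_sdiff_eq_self hC.2, h, Finset.sdiff_sdiff_eq_self hC'.2]
      · intro s hs
        have hs := Finset.mem_powerset.1 hs
        have hsub : J.boundaries ⊆ I.boundaries \ s := by
          intro x hx
          refine Finset.mem_sdiff.2 ⟨hJI hx, fun hxs => ?_⟩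
          exact (Finset.mem_sdiff.1 (hs hxs)).2 hx
        obtain ⟨C, hC⟩ : ∃ C : Composition n, C.boundaries = I.boundaries \ s :=
          ⟨_, CompositionAsSet.toComposition_boundaries (n := n) ⟨I.boundaries \ s,
            hsub J.zero_mem_boundaries, hsub J.last_mem_boundaries⟩⟩
        refine ⟨C, ?_, ?_⟩
        · rw [Finset.mem_filter, hC]
          exact ⟨Finset.mem_univ _, hsub, Finset.sdiff_subset⟩
        · rw [hC, Finset.sdiff_sdiff_eq_self (hs.trans Finset.sdiff_subset)]
      · intro C hC
        simp only [Finset.mem_filter, Finset.mem_univ, true_and] at hC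
        rw [Finset.card_sdiff_of_subset hC.2, I.card_boundaries_eq_succ_length,
          C.card_boundaries_eq_succ_length, Nat.add_sub_add_right]
    rw [Finset.sum_powerset_neg_one_pow_card] at h1
    have h2 := congrArg (Int.cast : ℤ → R) h1
    push_cast at h2
    rw [h2]
    congr 1
    rw [Finset.sdiff_eq_empty_iff_subset]
    exact propext ⟨fun h => hbd _ _ (hJI.antisymm h), fun h => h ▸ le_rfl⟩
  · rw [if_neg (by rintro rfl; exact hJI le_rfl), Finset.sum_eq_zero]
    intro C hC
    simp only [Finset.mem_filter, Finset.mem_univ, true_and] at hC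
    exact absurd (hC.1.trans hC.2) hJI

namespace NSym

variable (K : Type*) [Field K] {n : ℕ}

theorem completeProd_eq_sum_monomial [CharZero K] (I : Composition n) :
    completeProd K I =
      ∑ J : Composition n, wordCoeff I.blocks (listWord J.blocks) • monomial K J := by
  rw [completeProd, prod_S_eq_wordSum K _ I.blocks_forall_pos, I.blocks_sum,
    wordSum_eq_sum_composition]
  · refine Finset.sum_congr rfl fun J _ => ?_
    rw [wordMonomial, wordParts_listWord J.blocks_forall_pos, monomial]
  · intro y hy hne hlast
    rw [wordCoeff_eq_zero I.blocks I.blocks_forall_pos y (by rw [hy, I.blocks_sum]) hne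
      (by rwa [I.blocks_sum]), zero_smul]

/-- The expansion of products of complete functions on fundamental functions. -/
theorem completeProd_eq_sum_fundamental [CharZero K] (I : Composition n) :
    completeProd K I = ∑ σ : Equiv.Perm (Fin n) with
      (descentComposition σ⁻¹).boundaries ⊆ I.boundaries,
        fundamental K (genocchiComposition σ) := by
  rw [completeProd_eq_sum_monomial]
  -- Each coefficient is written as a sum over permutations; after the exchange of sums, the `Ψ_J`
  -- belonging to a fixed `σ` add up to `L_{GC(σ)}`.
  simp only [fundamental, ← card_filter_boundaries_subset, Finset.card_eq_sum_ones,
    Finset.sum_smul, one_smul]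
  rw [Finset.sum_comm']
  intro J σ
  simp only [Finset.mem_filter, Finset.mem_univ, true_and]
  tauto

/-- For fixed `σ` the signs are summed over the `C` between `D(σ⁻¹)` and `I`, which leaves only the
`σ` with `D(σ⁻¹) = I`. -/
theorem ribbon_eq_sum_fundamental [CharZero K] (I : Composition n) :
    ribbon K I = ∑ σ : Equiv.Perm (Fin n) with descentComposition σ⁻¹ = I,
      fundamental K (genocchiComposition σ) := by
  rw [ribbon]
  simp only [completeProd_eq_sum_fundamental, Finset.mul_sum]
  rw [Finset.sum_comm' (t' := Finset.univ) (s' := fun σ => Finset.univ.filter fun C =>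
    (descentComposition σ⁻¹).boundaries ⊆ C.boundaries ∧ C.boundaries ⊆ I.boundaries)]
  · simp only [← Finset.sum_mul, sum_compositions_neg_one_pow, ite_mul, one_mul, zero_mul]
    rw [Finset.sum_filter]
  · intro C σ
    simp only [Finset.mem_filter, Finset.mem_univ, true_and]
    tauto

/-- Distinct compositions give distinct words in the free monoid, that is, distinct members of the
standard basis of the free algebra. -/
theorem linearIndependent_completeProd :
    LinearIndependent K fun J : Composition n => completeProd K J := by
  set w : Composition n → FreeMonoid ℕ+ := fun J =>
    FreeMonoid.ofList (J.blocks.map fun i => (i - 1).succPNat) with hw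
  have hinj : Function.Injective w := by
    intro J J' h
    have h' := congrArg (fun l => (FreeMonoid.toList l).map fun i : ℕ+ => (i : ℕ)) h
    simp only [hw, FreeMonoid.toList_ofList, List.map_map] at h'
    have : ∀ C : Composition n,
        C.blocks.map ((fun i : ℕ+ => (i : ℕ)) ∘ fun i => (i - 1).succPNat) = C.blocks := by
      intro C
      conv_rhs => rw [← List.map_id C.blocks]
      refine List.map_congr_left fun i hi => ?_
      have := C.blocks_forall_pos i hi
      simp
      omega
    rw [this, this] at h'
    exact Composition.ext h'
  have hb : ∀ J : Composition n, completeProd K J = FreeAlgebra.basisFreeMonoid K ℕ+ (w J) := by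
    intro J
    have h1 : FreeAlgebra.basisFreeMonoid K ℕ+ (w J) =
        FreeAlgebra.equivMonoidAlgebraFreeMonoid.symm (MonoidAlgebra.of K _ (w J)) := rfl
    have h2 : FreeAlgebra.equivMonoidAlgebraFreeMonoid.symm (MonoidAlgebra.of K _ (w J)) =
        FreeMonoid.lift (FreeAlgebra.ι K) (w J) :=
      MonoidAlgebra.lift_of (FreeMonoid.lift (FreeAlgebra.ι K)) (w J)
    rw [h1, h2, FreeMonoid.lift_apply, completeProd]
    simp only [hw, FreeMonoid.toList_ofList, List.map_map]
    congr 1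
    refine List.map_congr_left fun i hi => ?_
    obtain ⟨k, rfl⟩ : ∃ k, i = k + 1 := ⟨i - 1, by have := J.blocks_forall_pos i hi; omega⟩
    rfl
  simp only [hb]
  exact (FreeAlgebra.basisFreeMonoid K ℕ+).linearIndependent.comp w hinj

/-- A dimension count: the span of the `L_J` contains every `S^I`, so its dimension is at least the
number of compositions. -/
theorem linearIndependent_fundamental [CharZero K] :
    LinearIndependent K fun J : Composition n => fundamental K J := by
  rw [linearIndependent_iff_card_le_finrank_span,
    linearIndependent_iff_card_eq_finrank_span.1 (linearIndependent_completeProd K)]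
  have : FiniteDimensional K
      (Submodule.span K (Set.range fun J : Composition n => fundamental K J)) :=
    FiniteDimensional.span_of_finite K (Set.finite_range _)
  apply Submodule.finrank_mono
  rw [Submodule.span_le]
  rintro _ ⟨I, rfl⟩
  dsimp only
  rw [completeProd_eq_sum_fundamental]
  exact Submodule.sum_mem _ fun σ _ => Submodule.subset_span ⟨_, rfl⟩

end NSym

end

theorem mainTheorem1 (K : Type*) [Field K] [CharZero K] (n : ℕ) :
    LinearIndependent K (fun J : Composition n => NSym.fundamental K J) ∧
    ∀ I : Composition n,
      NSym.ribbon K I =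
        ∑ J : Composition n, (genocchiNumber I J : K) • NSym.fundamental K J := by
  refine ⟨NSym.linearIndependent_fundamental K, fun I => ?_⟩
  rw [NSym.ribbon_eq_sum_fundamental, ← Finset.sum_fiberwise _ genocchiComposition]
  refine Finset.sum_congr rfl fun J _ => ?_
  rw [Finset.filter_filter, genocchiNumber, Nat.cast_smul_eq_nsmul]
  refine Finset.sum_eq_card_nsmul fun σ hσ => ?_
  rw [(Finset.mem_filter.1 hσ).2.2]
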